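/- Let $0\le\varepsilon<1$ be a constant and let $n_c=n_c(n)\in\mathbb N$ satisfy $n_c=o(n)$. Then for all sufficiently large $n$ the following holds. Let $f$ be the largest integer with $f<n/3$ (so $n=3f+1$ in the standard case), let $f$ of the $n$ nodes be Byzantine and the others honest, let $P_i$ be a node, and let $K\ge 0$ be arbitrary. Let $C_1,\dots,C_K$ be independent committees, each uniformly distributed among the $n_c$-element sets of nodes, and suppose that with probability at least $1-\varepsilon$ all of them contain a simple majority of honest nodes, i.e. $|\{j\in C_k: j\text{ honest}\}|>n_c/2$ for every $k$. The node $P_i$ sends its message $m$ to committees among $C_1,\dots,C_K$, at times of its choice (these may depend on everything that has happened and on its own coins). Every honest member that gets $m$ from $P_i$ through $C_k$ sends an acknowledgment back; a Byzantine member may do so or not; nodes outside $C_k$ do not. From each committee $P_i$ receives acknowledgments in their order of arrival, and only the first ones, at most $\lfloor n_c/2\rfloor+1$ of them. The network is fully asynchronous: an adversary, who controls the Byzantine nodes, chooses an arbitrary finite delay for every message (so every message is eventually delivered), except that what $P_i$ sends to itself is not delayed. Then $P_i$ cannot receive acknowledgments from $f+1$ distinct honest nodes with probability $1-\varepsilon$: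 there is an adversary, who even fixes all the delays relative to the sending times in advance and without knowledge of the sampled committees, such that for every behaviour of $P_i$ as above the probability that $P_i$ ever receives acknowledgments from at least $f+1$ distinct honest nodes is strictly less than $1-\varepsilon$. -/

import Mathlib

open MeasureTheory Filter Asymptotics
open scoped ENNReal

/-- The `K` random committees `C ω 0, …, C ω (K-1)` are independent and uniformly distributed among
the subsets of size `s` of the `n` nodes: jointly, every `K`-tuple of such subsets has the same
probability `(n choose s)^(-K)`. -/
structure IsUniformSample {Ω : Type*} [MeasurableSpace Ω] (μ : Measure Ω) {K n : ℕ} (s : ℕ)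
    (C : Ω → Fin K → Finset (Fin n)) : Prop where
  measurable : ∀ c : Fin K → Finset (Fin n), MeasurableSet {ω | C ω = c}
  law : ∀ c : Fin K → Finset (Fin n), (∀ k, (c k).card = s) →
    μ {ω | C ω = c} = ((n.choose s : ℝ≥0∞) ^ K)⁻¹

/-- More than half of the committee is honest (that is, not in `byz`). -/
def HonestMajority {n : ℕ} (byz : Finset (Fin n)) (committee : Finset (Fin n)) : Prop :=
  committee.card < 2 * (committee \ byz).card

/-- An adversary against the node `sender` in a fully asynchronous network, with corrupted set `byz`.
It chooses the delay of every message. All delays are finite, so that every message is eventually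
delivered, but they are otherwise unbounded. They are fixed in advance, without knowledge of the
sampled committees. The Byzantine nodes may stay silent; honest nodes may not. -/
structure AsyncAdversary (K : ℕ) {n : ℕ} (byz : Finset (Fin n)) (sender : Fin n) where
  /-- delay of the message that `sender` sends to a node as a member of the `k`-th committee -/
  reqDelay : Fin K → Fin n → ℕ
  /-- delay of the acknowledgment that this node sends back -/
  ackDelay : Fin K → Fin n → ℕ
  /-- the nodes that do not acknowledge as members of the `k`-th committee -/
  silent : Fin K → Finset (Fin n)
  silent_subset : ∀ k, silent k ⊆ byz
  /-- what the sender sends to itself is not delayed -/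
  reqDelay_self : ∀ k, reqDelay k sender = 0
  ackDelay_self : ∀ k, ackDelay k sender = 0
  /-- no two acknowledgments from the same committee arrive at the same time -/
  no_tie : ∀ k, Function.Injective fun j => reqDelay k j + ackDelay k j

/-- What the sender does in one run: when (if ever) it sends its message to the `k`-th committee, and
how many acknowledgments it receives from that committee before it turns to something else, which are
at most `q`. -/
structure SenderRun (K q : ℕ) where
  contact : Fin K → Option ℕ
  quota : Fin K → ℕ
  quota_le : ∀ k, quota k ≤ q

section Run

variable {K n q : ℕ} {byz : Finset (Fin n)} {sender : Fin n}

/-- The acknowledgment of node `j`, as a member of the `k`-th committee, reaches the sender at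
time `t`. -/
def AckArrives (A : AsyncAdversary K byz sender) (R : SenderRun K q) (c : Fin K → Finset (Fin n))
    (k : Fin K) (j : Fin n) (t : ℕ) : Prop :=
  j ∈ c k ∧ j ∉ A.silent k ∧
    ∃ t₀, R.contact k = some t₀ ∧ t = t₀ + A.reqDelay k j + A.ackDelay k j

/-- The sender receives the acknowledgment of node `j` from the `k`-th committee: it arrives, and
when it does the quota of that committee is not yet exhausted by earlier arrivals. -/
def ReceivesAck (A : AsyncAdversary K byz sender) (R : SenderRun K q) (c : Fin K → Finset (Fin n))
    (k : Fin K) (j : Fin n) : Prop :=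
  ∃ t, AckArrives A R c k j t ∧
    {j' : Fin n | ∃ t' < t, AckArrives A R c k j' t'}.ncard < R.quota k

/-- The honest nodes from which the sender receives an acknowledgment, at any time and through any
committee. -/
def honestAcks (A : AsyncAdversary K byz sender) (R : SenderRun K q)
    (c : Fin K → Finset (Fin n)) : Set (Fin n) :=
  {j | j ∉ byz ∧ ∃ k, ReceivesAck A R c k j}

end Run

/-! ### Counting committees by the size of their intersection with a fixed set -/

/-! Fix a constant `T > 32 / δ ^ 2` with `δ = 1 - ε`. The adversary picks a fast set `F` containing
the sender and all Byzantine nodes, with only `f + 1 - T` honest members, and lets `F` answer first;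
Byzantine nodes do answer, to use up the quotas. So `T` acknowledgments from slow nodes (outside
`F`) are needed. A committee yields one only if at least half of it is slow, and then only the
excess over that half counts (`card_slow_le_of_receivesAck`).

There are hardly more slow nodes than Byzantine ones, so a committee is half slow about as rarely as
it lacks an honest majority, an event of probability `p`. Geometric decay of the hypergeometric tail
bounds the expected excess by `32 * p` (`sum_excess_le`, `choose_add_le_two_mul`). Since all `K`
committees are good with probability at least `δ`, `K * p ≤ 1 / δ`. By Markov's inequality the total
excess reaches `T` with probability at most `32 / (δ * T) < δ`. The excess is summed over all
committees, so the sender's strategy is irrelevant. -/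

theorem card_filter_card_inter_eq {n : ℕ} (s a : ℕ) (has : a ≤ s) (G : Finset (Fin n)) :
    (((Finset.univ : Finset (Fin n)).powersetCard s).filter fun c => (c ∩ G).card = a).card
      = G.card.choose a * (n - G.card).choose (s - a) := by
  have hc : n - G.card = Gᶜ.card := by rw [Finset.card_compl, Fintype.card_fin]
  rw [hc, ← Finset.card_powersetCard, ← Finset.card_powersetCard, ← Finset.card_product]
  refine Finset.card_bij' (fun c _ => (c ∩ G, c \ G)) (fun x _ => x.1 ∪ x.2) ?_ ?_ ?_ ?_
  · intro c hc
    simp only [Finset.mem_filter, Finset.mem_powersetCard, Finset.subset_univ, true_and] at hc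
    have h := Finset.card_inter_add_card_sdiff c G
    simp only [Finset.mem_product, Finset.mem_powersetCard]
    refine ⟨⟨Finset.inter_subset_right, hc.2⟩, ?_, by omega⟩
    intro x hx
    simp only [Finset.mem_sdiff] at hx
    simpa using hx.2
  · rintro ⟨x, y⟩ hxy
    simp only [Finset.mem_product, Finset.mem_powersetCard] at hxy
    obtain ⟨⟨hx, hxc⟩, hy, hyc⟩ := hxy
    have hd : Disjoint x y :=
      Finset.disjoint_of_subset_left hx (Finset.disjoint_of_subset_right hy disjoint_compl_right)
    have hi : (x ∪ y) ∩ G = x := by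
      ext j
      have h1 := @hx j
      have h2 := @hy j
      simp only [Finset.mem_compl] at h2
      simp only [Finset.mem_inter, Finset.mem_union]
      tauto
    simp only [Finset.mem_filter, Finset.mem_powersetCard, Finset.subset_univ, true_and]
    refine ⟨?_, by rw [hi, hxc]⟩
    rw [Finset.card_union_of_disjoint hd]
    omega
  · intro c _
    ext j
    simp only [Finset.mem_inter, Finset.mem_union, Finset.mem_sdiff]
    tauto
  · rintro ⟨x, y⟩ hxy
    simp only [Finset.mem_product, Finset.mem_powersetCard] at hxy
    obtain ⟨⟨hx, -⟩, hy, -⟩ := hxy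
    ext j <;>
    · have h1 := @hx j
      have h2 := @hy j
      simp only [Finset.mem_compl] at h2
      simp only [Finset.mem_inter, Finset.mem_union, Finset.mem_sdiff]
      tauto

/-- The hypergeometric weights decay geometrically beyond half of the sample size. -/
theorem choose_mul_choose_succ_le {m M s a : ℕ} (ha : s ≤ 2 * a) (has : a < s)
    (hm : 4 * m + 3 * s ≤ 3 * M) :
    4 * (m.choose (a + 1) * M.choose (s - (a + 1))) ≤ 3 * (m.choose a * M.choose (s - a)) := by
  obtain ⟨b, rfl⟩ : ∃ b, s = a + 1 + b := ⟨s - (a + 1), by omega⟩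
  have e1 : a + 1 + b - (a + 1) = b := by omega
  have e2 : a + 1 + b - a = b + 1 := by omega
  rw [e1, e2]
  have h1 := Nat.choose_succ_right_eq m a
  have h2 := Nat.choose_succ_right_eq M b
  have hpos : 0 < (a + 1) * (M - b) := Nat.mul_pos (by omega) (by omega)
  refine Nat.le_of_mul_le_mul_right ?_ hpos
  calc 4 * (m.choose (a + 1) * M.choose b) * ((a + 1) * (M - b))
      = 4 * ((m.choose (a + 1) * (a + 1)) * (M.choose b * (M - b))) := by ring
    _ = (m.choose a * M.choose (b + 1)) * ((4 * (m - a)) * (b + 1)) := by rw [h1, ← h2]; ring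
    -- Past the middle, `b + 1 = s - a ≤ a`; the factor 3/4 comes from `hm` alone.
    _ ≤ (m.choose a * M.choose (b + 1)) * ((3 * (M - b)) * (a + 1)) := by
        gcongr ?_ * (?_ * ?_) <;> omega
    _ = 3 * (m.choose a * M.choose (b + 1)) * ((a + 1) * (M - b)) := by ring

theorem choose_mul_choose_add_le {m M s h : ℕ} (hh : s ≤ 2 * h) (hm : 4 * m + 3 * s ≤ 3 * M)
    (t : ℕ) (ht : h + t ≤ s) :
    ((m.choose (h + t) * M.choose (s - (h + t)) : ℕ) : ℝ)
      ≤ (3 / 4) ^ t * (m.choose h * M.choose (s - h) : ℕ) := by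
  induction t with
  | zero => simp
  | succ t ih =>
    have h1 := choose_mul_choose_succ_le (m := m) (M := M) (s := s) (a := h + t)
      (by omega) (by omega) hm
    have h2 : (4 : ℝ) * (m.choose (h + t + 1) * M.choose (s - (h + t + 1)) : ℕ)
        ≤ 3 * (m.choose (h + t) * M.choose (s - (h + t)) : ℕ) := by exact_mod_cast h1
    have h3 := ih (by omega)
    rw [← add_assoc, pow_succ]
    linarith

theorem sum_succ_mul_three_quarters_pow_le (N : ℕ) :
    ∑ t ∈ Finset.range N, ((t : ℝ) + 1) * (3 / 4) ^ t ≤ 16 := by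
  -- The added term is the tail of the series from `N` on; the full sum is `1 / (1 - 3/4) ^ 2 = 16`.
  have h : ∑ t ∈ Finset.range N, ((t : ℝ) + 1) * (3 / 4) ^ t + (4 * N + 16) * (3 / 4) ^ N = 16 := by
    induction N with
    | zero => simp
    | succ N ih =>
      rw [Finset.sum_range_succ, pow_succ]
      push_cast
      linarith
  have : (0 : ℝ) ≤ (4 * N + 16) * (3 / 4) ^ N := by positivity
  linarith

/-- The sum, over all committees, of the excess of the intersection with `G` over half of the
committee. -/
theorem sum_excess_le {n : ℕ} {s h : ℕ} (G : Finset (Fin n)) (hh : s ≤ 2 * h) (hhs : h ≤ s)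
    (hm : 4 * G.card + 3 * s ≤ 3 * (n - G.card)) :
    ∑ c ∈ (Finset.univ : Finset (Fin n)).powersetCard s, (((c ∩ G).card + 1 - h : ℕ) : ℝ)
      ≤ 16 * (G.card.choose h * (n - G.card).choose (s - h) : ℕ) := by
  have hmaps : ∀ c ∈ (Finset.univ : Finset (Fin n)).powersetCard s,
      (c ∩ G).card ∈ Finset.range (s + 1) := by
    intro c hc
    rw [Finset.mem_powersetCard] at hc
    have := Finset.card_le_card (Finset.inter_subset_left : c ∩ G ⊆ c)
    rw [Finset.mem_range]
    omega
  rw [← Finset.sum_fiberwise_of_maps_to hmaps]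
  have hfib : ∀ a ∈ Finset.range (s + 1),
      ∑ c ∈ ((Finset.univ : Finset (Fin n)).powersetCard s).filter fun c => (c ∩ G).card = a,
        (((c ∩ G).card + 1 - h : ℕ) : ℝ)
      = ((a + 1 - h : ℕ) : ℝ) * (G.card.choose a * (n - G.card).choose (s - a) : ℕ) := by
    intro a ha
    rw [Finset.mem_range] at ha
    rw [← card_filter_card_inter_eq s a (by omega) G, mul_comm, ← nsmul_eq_mul]
    refine Finset.sum_eq_card_nsmul fun c hc => ?_
    rw [(Finset.mem_filter.1 hc).2]
  rw [Finset.sum_congr rfl hfib]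
  obtain ⟨r, rfl⟩ : ∃ r, s = h + r := ⟨s - h, by omega⟩
  rw [add_assoc, Finset.sum_range_add]
  -- Truncated subtraction kills the terms below `h`; the term `a = h + t` has weight `t + 1`.
  have hzero : ∑ a ∈ Finset.range h, ((a + 1 - h : ℕ) : ℝ)
      * (G.card.choose a * (n - G.card).choose (h + r - a) : ℕ) = 0 := by
    refine Finset.sum_eq_zero fun a ha => ?_
    rw [Finset.mem_range] at ha
    have : a + 1 - h = 0 := by omega
    simp [this]
  rw [hzero, zero_add]
  calc _ ≤ ∑ t ∈ Finset.range (r + 1), ((t : ℝ) + 1) * (3 / 4) ^ t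
          * (G.card.choose h * (n - G.card).choose (h + r - h) : ℕ) := by
        refine Finset.sum_le_sum fun t ht => ?_
        rw [Finset.mem_range] at ht
        have e : h + t + 1 - h = t + 1 := by omega
        rw [e, mul_assoc]
        push_cast only [Nat.cast_add, Nat.cast_one]
        exact mul_le_mul_of_nonneg_left (choose_mul_choose_add_le hh hm t (by omega))
          (by positivity)
    _ ≤ _ := by
        rw [← Finset.sum_mul]
        exact mul_le_mul_of_nonneg_right (sum_succ_mul_three_quarters_pow_le _) (Nat.cast_nonneg _)

/-- Removing one element from a ground set of size `N + 1 > f` multiplies the binomial coefficient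
by `1 - h / (N + 1) ≥ 1 - h / f`. -/
theorem choose_add_mul_le (f h d : ℕ) (hf : 0 < f) (hhf : h ≤ f) :
    ((f + d).choose h : ℝ) * (1 - h / f) ^ d ≤ f.choose h := by
  have hf' : (0 : ℝ) < f := by exact_mod_cast hf
  have hx : 0 ≤ 1 - (h : ℝ) / f := by
    rw [sub_nonneg, div_le_one hf']
    exact_mod_cast hhf
  induction d with
  | zero => simp
  | succ d ih =>
    have h1 : ((f + d + 1).choose h : ℝ) * (f + d + 1 - h) = (f + d).choose h * (f + d + 1) := by
      have := Nat.choose_mul_succ_eq (f + d) h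
      have h2 : ((f + d + 1 - h : ℕ) : ℝ) = f + d + 1 - h := by
        rw [Nat.cast_sub (by omega)]
        push_cast
        ring
      rw [← h2]
      exact_mod_cast this.symm
    have h3 : (f + d + 1 : ℝ) * (1 - h / f) ≤ f + d + 1 - h := by
      have : (h : ℝ) ≤ (f + d + 1) * (h / f) := by
        rw [mul_div_assoc', le_div_iff₀ hf']
        have : (0 : ℝ) ≤ (d + 1) * h := by positivity
        nlinarith
      linarith
    have h4 : ((f + d + 1).choose h : ℝ) * (1 - h / f) ≤ (f + d).choose h := by
      have hpos : (0 : ℝ) < f + d + 1 := by positivity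
      refine le_of_mul_le_mul_right ?_ hpos
      rw [← h1, mul_assoc]
      refine mul_le_mul_of_nonneg_left ?_ (Nat.cast_nonneg _)
      linarith
    calc ((f + (d + 1)).choose h : ℝ) * (1 - h / f) ^ (d + 1)
        = ((f + d + 1).choose h * (1 - h / f)) * (1 - h / f) ^ d := by
          rw [← add_assoc]
          ring
      _ ≤ (f + d).choose h * (1 - h / f) ^ d :=
          mul_le_mul_of_nonneg_right h4 (pow_nonneg hx d)
      _ ≤ _ := ih

/-- Enlarging the ground set by few elements at most doubles the binomial coefficient. -/
theorem choose_add_le_two_mul (f h d : ℕ) (hf : 0 < f) (hd : 2 * (d * h) ≤ f) (hhf : h ≤ f) :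
    (f + d).choose h ≤ 2 * f.choose h := by
  have hf' : (0 : ℝ) < f := by exact_mod_cast hf
  have h1 := choose_add_mul_le f h d hf hhf
  have hx : (h : ℝ) / f ≤ 1 := by
    rw [div_le_one hf']
    exact_mod_cast hhf
  -- Bernoulli: `(1 - h / f) ^ d ≥ 1 - d * h / f ≥ 1 / 2`.
  have h2 := one_add_mul_le_pow (a := -((h : ℝ) / f)) (by linarith) d
  have h3 : (d : ℝ) * (h / f) ≤ 1 / 2 := by
    rw [mul_div_assoc', div_le_iff₀ hf']
    have : (2 : ℝ) * (d * h) ≤ f := by exact_mod_cast hd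
    linarith
  have h4 : (1 / 2 : ℝ) ≤ (1 - h / f) ^ d := by
    rw [sub_eq_add_neg]
    linarith
  have h5 : ((f + d).choose h : ℝ) * (1 / 2) ≤ f.choose h :=
    (mul_le_mul_of_nonneg_left h4 (Nat.cast_nonneg _)).trans h1
  have h6 : ((f + d).choose h : ℝ) ≤ 2 * f.choose h := by linarith
  exact_mod_cast h6

/-- The number of committees without honest majority. -/
theorem choose_mul_choose_le_card_not_honestMajority {n : ℕ} {s h : ℕ} (byz : Finset (Fin n))
    (hh : s ≤ 2 * h) (hhs : h ≤ s) [DecidablePred (HonestMajority byz)] :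
    byz.card.choose h * (n - byz.card).choose (s - h)
      ≤ (((Finset.univ : Finset (Fin n)).powersetCard s).filter
          fun c => ¬ HonestMajority byz c).card := by
  -- Committees with exactly `h` Byzantine members suffice, as the excess is also bounded by its
  -- term at `h`.
  rw [← card_filter_card_inter_eq s h hhs byz]
  refine Finset.card_le_card fun c hc => ?_
  simp only [Finset.mem_filter, Finset.mem_powersetCard, Finset.subset_univ, true_and] at hc ⊢
  have := Finset.card_inter_add_card_sdiff c byz
  refine ⟨hc.1, ?_⟩
  unfold HonestMajority
  omega

/-! ### Probabilities as proportions of tuples of committees -/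

/-- The `K`-tuples of `s`-element committees. -/
def committeeTuples (K n s : ℕ) : Finset (Fin K → Finset (Fin n)) :=
  Fintype.piFinset fun _ => (Finset.univ : Finset (Fin n)).powersetCard s

theorem mem_committeeTuples {K n s : ℕ} {c : Fin K → Finset (Fin n)} :
    c ∈ committeeTuples K n s ↔ ∀ k, (c k).card = s := by
  simp [committeeTuples, Fintype.mem_piFinset, Finset.mem_powersetCard]

theorem card_committeeTuples (K n s : ℕ) : (committeeTuples K n s).card = n.choose s ^ K := by
  simp [committeeTuples]

section Sample

variable {Ω : Type*} [MeasurableSpace Ω] {μ : Measure Ω} [IsProbabilityMeasure μ] {K n s : ℕ}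
  {C : Ω → Fin K → Finset (Fin n)}

theorem IsUniformSample.measureReal_mem (hC : IsUniformSample μ s C)
    {S : Finset (Fin K → Finset (Fin n))} (hS : S ⊆ committeeTuples K n s) :
    μ.real {ω | C ω ∈ S} = S.card / (n.choose s : ℝ) ^ K := by
  have hU : {ω | C ω ∈ S} = ⋃ c ∈ S, {ω | C ω = c} := by
    ext ω
    simp
  rw [hU, measureReal_biUnion_finset]
  · have : ∀ c ∈ S, μ.real {ω | C ω = c} = ((n.choose s : ℝ) ^ K)⁻¹ := by
      intro c hc
      rw [Measure.real, hC.law c (mem_committeeTuples.1 (hS hc))]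
      simp
    rw [Finset.sum_congr rfl this, Finset.sum_const, nsmul_eq_mul, div_eq_mul_inv]
  · intro c _ c' _ hcc
    refine Set.disjoint_left.2 fun ω h h' => hcc ?_
    exact Eq.trans (Eq.symm h) h'
  · exact fun c _ => hC.measurable c

/-- `law` is silent on tuples of other sizes, but the masses it prescribes already add up to 1. -/
theorem IsUniformSample.ae_mem (hC : IsUniformSample μ s C) (hs : s ≤ n) :
    ∀ᵐ ω ∂μ, C ω ∈ committeeTuples K n s := by
  have hpos : (0 : ℝ) < (n.choose s : ℝ) ^ K := by
    have := Nat.choose_pos hs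
    positivity
  have h1 := hC.measureReal_mem (Finset.Subset.refl _)
  rw [card_committeeTuples, Nat.cast_pow, div_self hpos.ne'] at h1
  have hmeas : MeasurableSet {ω | C ω ∈ committeeTuples K n s} := by
    have hU : {ω | C ω ∈ committeeTuples K n s}
        = ⋃ c ∈ committeeTuples K n s, {ω | C ω = c} := by
      ext ω
      simp
    rw [hU]
    exact Finset.measurableSet_biUnion _ fun c _ => hC.measurable c
  have h2 : μ {ω | C ω ∈ committeeTuples K n s} = 1 := by
    rw [← ofReal_measureReal, h1, ENNReal.ofReal_one]
  exact (mem_ae_iff_prob_eq_one hmeas).2 h2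

/-- `E` need not be measurable: it will involve the sender's run, an arbitrary function of `ω`.
Monotonicity of `μ` is enough. -/
theorem IsUniformSample.measureReal_le (hC : IsUniformSample μ s C) (hs : s ≤ n)
    {E : Ω → Prop} {P : (Fin K → Finset (Fin n)) → Prop} [DecidablePred P]
    (h : ∀ ω, C ω ∈ committeeTuples K n s → E ω → P (C ω)) :
    μ.real {ω | E ω} ≤ ((committeeTuples K n s).filter P).card / (n.choose s : ℝ) ^ K := by
  rw [← hC.measureReal_mem (Finset.filter_subset _ _)]
  refine ENNReal.toReal_mono (measure_ne_top _ _) (measure_mono_ae ?_)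
  filter_upwards [hC.ae_mem hs] with ω hω hE
  exact Finset.mem_filter.2 ⟨hω, h ω hω hE⟩

/-- If all committees have an honest majority with probability at least `δ`, then the expected
number of those without is at most `1 / δ`. -/
theorem IsUniformSample.mul_card_not_honestMajority_le (hC : IsUniformSample μ s C) (hs : s ≤ n)
    (byz : Finset (Fin n)) [DecidablePred (HonestMajority byz)] {δ : ℝ} (hδ : 0 < δ)
    (hμ : δ ≤ μ.real {ω | ∀ k, HonestMajority byz (C ω k)}) :
    K * ((((Finset.univ : Finset (Fin n)).powersetCard s).filter
          fun c => ¬ HonestMajority byz c).card / (n.choose s : ℝ)) ≤ 1 / δ := by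
  classical
  have hN : (0 : ℝ) < n.choose s := by exact_mod_cast Nat.choose_pos hs
  set 𝒮 := (Finset.univ : Finset (Fin n)).powersetCard s with h𝒮
  have hcard : (𝒮.filter (HonestMajority byz)).card
      + (𝒮.filter fun c => ¬ HonestMajority byz c).card = n.choose s := by
    rw [Finset.card_filter_add_card_filter_not]
    simp [h𝒮]
  have h1 := hμ.trans (hC.measureReal_le hs (P := fun c => ∀ k, HonestMajority byz (c k))
    fun ω _ h => h)
  have h2 : (committeeTuples K n s).filter (fun c => ∀ k, HonestMajority byz (c k))
      = Fintype.piFinset fun _ => 𝒮.filter (HonestMajority byz) := by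
    ext c
    simp only [committeeTuples, Finset.mem_filter, Fintype.mem_piFinset, forall_and]
    rfl
  rw [h2, Fintype.card_piFinset_const, Nat.cast_pow, ← div_pow] at h1
  set p : ℝ := (𝒮.filter fun c => ¬ HonestMajority byz c).card / (n.choose s : ℝ) with hp
  have hp0 : 0 ≤ p := by positivity
  have h3 : ((𝒮.filter (HonestMajority byz)).card : ℝ) / n.choose s = 1 - p := by
    rw [hp, eq_sub_iff_add_eq, ← add_div, div_eq_one_iff_eq hN.ne']
    exact_mod_cast hcard
  have hp1 : 0 ≤ 1 - p := by
    rw [← h3]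
    positivity
  rw [h3] at h1
  -- `(1 + p) * (1 - p) ≤ 1` turns the lower bound on `(1 - p) ^ K` into an upper bound on `(1 + p)
  -- ^ K ≥ 1 + K * p`.
  have h4 := one_add_mul_le_pow (a := p) (by linarith) K
  have h5 : (1 + p) ^ K * (1 - p) ^ K ≤ 1 := by
    rw [← mul_pow]
    exact pow_le_one₀ (by positivity) (by nlinarith)
  have h6 : (K * p) * δ ≤ 1 := by
    have hKp : 0 ≤ K * p := by positivity
    calc (K * p) * δ ≤ (1 + K * p) * δ := by gcongr; linarith
      _ ≤ (1 + p) ^ K * (1 - p) ^ K := by gcongr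
      _ ≤ 1 := h5
  rwa [le_div_iff₀ hδ]

/-- Markov's inequality for the sum of a statistic of the committees. -/
theorem card_filter_le_sum_mul_le (X : Finset (Fin n) → ℕ) (T : ℕ) (hs : s ≤ n) :
    (((committeeTuples K n s).filter fun c => T ≤ ∑ k, X (c k)).card / (n.choose s : ℝ) ^ K) * T
      ≤ K * ((∑ c ∈ (Finset.univ : Finset (Fin n)).powersetCard s, (X c : ℝ)) / n.choose s) := by
  have hN : (0 : ℝ) < n.choose s := by exact_mod_cast Nat.choose_pos hs
  have h1 : (((committeeTuples K n s).filter fun c => T ≤ ∑ k, X (c k)).card : ℝ) * T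
      ≤ ∑ c ∈ committeeTuples K n s, ∑ k, (X (c k) : ℝ) := by
    rw [← nsmul_eq_mul]
    refine (Finset.card_nsmul_le_sum _ (fun c => ∑ k, (X (c k) : ℝ)) _ fun c hc => ?_).trans
      (Finset.sum_le_sum_of_subset_of_nonneg (Finset.filter_subset _ _) fun _ _ _ => by positivity)
    exact_mod_cast (Finset.mem_filter.1 hc).2
  have h2 : ∑ c ∈ committeeTuples K n s, ∑ k, (X (c k) : ℝ)
      = K * ((n.choose s : ℝ) ^ (K - 1)
        * ∑ c ∈ (Finset.univ : Finset (Fin n)).powersetCard s, (X c : ℝ)) := by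
    rw [Finset.sum_comm]
    have : ∀ k : Fin K, ∑ c ∈ committeeTuples K n s, (X (c k) : ℝ) = (n.choose s : ℝ) ^ (K - 1)
        * ∑ c ∈ (Finset.univ : Finset (Fin n)).powersetCard s, (X c : ℝ) := by
      intro k
      rw [committeeTuples, Fintype.sum_piFinset_apply (fun c => (X c : ℝ))]
      simp
    rw [Finset.sum_congr rfl fun k _ => this k]
    simp
  rw [h2] at h1
  rw [div_mul_eq_mul_div, div_le_iff₀ (by positivity)]
  refine h1.trans (le_of_eq ?_)
  -- For `K = 0` the exponent `K - 1` truncates, but the factor `K` makes both sides vanish.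
  rcases K with _ | K
  · simp
  · rw [Nat.add_sub_cancel, pow_succ]
    field_simp

end Sample

/-! ### The adversary that delays the nodes outside a given set -/

/-- The sender comes first, then the other nodes of `F`, then all other nodes. -/
def fastRank {n : ℕ} (F : Finset (Fin n)) (sender j : Fin n) : ℕ :=
  if j = sender then 0 else if j ∈ F then j + 1 else n + 1 + j

theorem fastRank_injective {n : ℕ} (F : Finset (Fin n)) (sender : Fin n) :
    Function.Injective (fastRank F sender) := by
  intro i j h
  unfold fastRank at h
  apply Fin.ext
  split_ifs at h <;> omega

theorem fastRank_lt {n : ℕ} {F : Finset (Fin n)} {sender i j : Fin n} (hs : sender ∈ F)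
    (hi : i ∈ F) (hj : j ∉ F) : fastRank F sender i < fastRank F sender j := by
  have hjs : j ≠ sender := fun h => hj (h ▸ hs)
  unfold fastRank
  rw [if_neg hjs, if_neg hj, if_pos hi]
  split_ifs <;> omega

/-- All acknowledgments are sent, those from outside `F` with the largest delays. -/
def fastFirstAdversary (K : ℕ) {n : ℕ} (byz : Finset (Fin n)) (sender : Fin n)
    (F : Finset (Fin n)) : AsyncAdversary K byz sender where
  reqDelay _ _ := 0
  ackDelay _ j := fastRank F sender j
  silent _ := ∅
  silent_subset _ := Finset.empty_subset _
  reqDelay_self _ := rfl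
  ackDelay_self _ := by simp [fastRank]
  no_tie _ := by simpa using fastRank_injective F sender

section Adversary

variable {K n q : ℕ} {byz F : Finset (Fin n)} {sender : Fin n}

theorem ackArrives_fastFirstAdversary {R : SenderRun K q} {c : Fin K → Finset (Fin n)} {k : Fin K}
    {j : Fin n} {t : ℕ} : AckArrives (fastFirstAdversary K byz sender F) R c k j t ↔
      j ∈ c k ∧ ∃ t₀, R.contact k = some t₀ ∧ t = t₀ + fastRank F sender j := by
  simp [AckArrives, fastFirstAdversary]

/-- A slow node is heard only after all fast ones. -/
theorem card_slow_le_of_receivesAck (hs : sender ∈ F) (R : SenderRun K q)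
    (c : Fin K → Finset (Fin n)) (k : Fin K) (D : Finset (Fin n))
    (hD : ∀ j ∈ D, j ∉ F ∧ ReceivesAck (fastFirstAdversary K byz sender F) R c k j) :
    D.card ≤ (c k ∩ Fᶜ).card + q - (c k).card := by
  rcases D.eq_empty_or_nonempty with rfl | hne
  · simp
  -- Before the last slow node `j` come the rest of `D` and every fast member, and together they
  -- leave the quota unexhausted.
  obtain ⟨j, hj, hmax⟩ := D.exists_max_image (fastRank F sender) hne
  obtain ⟨hjF, t, harr, hlt⟩ := hD j hj
  rw [ackArrives_fastFirstAdversary] at harr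
  obtain ⟨-, t₀, ht₀, rfl⟩ := harr
  have hsub : ((D.erase j ∪ (c k ∩ F) : Finset (Fin n)) : Set (Fin n)) ⊆
      {j' | ∃ t' < t₀ + fastRank F sender j,
        AckArrives (fastFirstAdversary K byz sender F) R c k j' t'} := by
    intro i hi
    rw [Finset.mem_coe, Finset.mem_union, Finset.mem_erase, Finset.mem_inter] at hi
    have key : i ∈ c k ∧ fastRank F sender i < fastRank F sender j := by
      rcases hi with ⟨hij, hiD⟩ | ⟨hic, hiF⟩
      · obtain ⟨-, t', harr', -⟩ := hD i hiD
        exact ⟨(ackArrives_fastFirstAdversary.1 harr').1, lt_of_le_of_ne (hmax i hiD)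
          fun h => hij (fastRank_injective F sender h)⟩
      · exact ⟨hic, fastRank_lt hs hiF hjF⟩
    exact ⟨t₀ + fastRank F sender i, by omega,
      ackArrives_fastFirstAdversary.2 ⟨key.1, t₀, ht₀, rfl⟩⟩
  have hle := Set.ncard_le_ncard hsub (Set.toFinite _)
  rw [Set.ncard_coe_finset] at hle
  have hdisj : Disjoint (D.erase j) (c k ∩ F) := by
    refine Finset.disjoint_left.2 fun i hi hi' => ?_
    exact (hD i (Finset.mem_of_mem_erase hi)).1 (Finset.mem_inter.1 hi').2
  rw [Finset.card_union_of_disjoint hdisj, Finset.card_erase_of_mem hj] at hle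
  have hq := R.quota_le k
  have hpos := hne.card_pos
  have hsplit := Finset.card_inter_add_card_sdiff (c k) F
  rw [Finset.sdiff_eq_inter_compl] at hsplit
  omega

theorem ncard_honestAcks_le (hs : sender ∈ F) (R : SenderRun K q) (c : Fin K → Finset (Fin n)) :
    (honestAcks (fastFirstAdversary K byz sender F) R c).ncard
      ≤ (F \ byz).card + ∑ k, ((c k ∩ Fᶜ).card + q - (c k).card) := by
  classical
  let D : Fin K → Finset (Fin n) := fun k => Finset.univ.filter fun j =>
    j ∉ F ∧ ReceivesAck (fastFirstAdversary K byz sender F) R c k j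
  have hsub : honestAcks (fastFirstAdversary K byz sender F) R c
      ⊆ ((F \ byz ∪ Finset.univ.biUnion D : Finset (Fin n)) : Set (Fin n)) := by
    rintro j ⟨hj, k, hk⟩
    rw [Finset.mem_coe, Finset.mem_union]
    by_cases hjF : j ∈ F
    · exact Or.inl (Finset.mem_sdiff.2 ⟨hjF, hj⟩)
    · refine Or.inr (Finset.mem_biUnion.2 ⟨k, Finset.mem_univ _, ?_⟩)
      exact Finset.mem_filter.2 ⟨Finset.mem_univ _, hjF, hk⟩
  refine (Set.ncard_le_ncard hsub (Set.toFinite _)).trans ?_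
  rw [Set.ncard_coe_finset]
  refine (Finset.card_union_le _ _).trans (Nat.add_le_add_left ?_ _)
  refine Finset.card_biUnion_le.trans (Finset.sum_le_sum fun k _ => ?_)
  exact card_slow_le_of_receivesAck hs R c k (D k) fun j hj => (Finset.mem_filter.1 hj).2

end Adversary

/-- The bound for fixed parameters: `T` is the number of slow nodes that the sender would have to
hear, and the committee size `s` is small compared to `f / T`. -/
theorem exists_adversary_measureReal_lt {δ : ℝ} (hδ : 0 < δ) {T : ℕ} (hT : 32 / δ ^ 2 < T)
    {n s f : ℕ} (hf : 3 * f < n) (hn : n ≤ 3 * f + 3) (hTf : 14 * T + 14 ≤ f)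
    (hsf : 2 * ((T + 2) * s) ≤ f)
    {byz : Finset (Fin n)} (hbyz : byz.card = f) (sender : Fin n) {K : ℕ}
    {Ω : Type*} [MeasurableSpace Ω] {μ : Measure Ω} [IsProbabilityMeasure μ]
    {C : Ω → Fin K → Finset (Fin n)} (hC : IsUniformSample μ s C)
    (hμ : δ ≤ μ.real {ω | ∀ k, HonestMajority byz (C ω k)}) :
    ∃ A : AsyncAdversary K byz sender, ∀ R : Ω → SenderRun K (s / 2 + 1),
      μ.real {ω | f + 1 ≤ (honestAcks A (R ω) (C ω)).ncard} < δ := by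
  classical
  have hTs : 2 * s ≤ (T + 2) * s := Nat.mul_le_mul_right _ (by omega)
  have hsn : s ≤ n := by omega
  obtain ⟨F, hsubF, -, hFcard⟩ := Finset.exists_subsuperset_card_eq
    (Finset.subset_univ (insert sender byz)) (n := 2 * f + 1 - T)
    ((Finset.card_insert_le _ _).trans (by omega)) (by simp; omega)
  have hsF : sender ∈ F := hsubF (Finset.mem_insert_self _ _)
  have hbF : byz ⊆ F := (Finset.subset_insert _ _).trans hsubF
  have hFb : (F \ byz).card = f + 1 - T := by
    rw [Finset.card_sdiff_of_subset hbF]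
    omega
  have hG : Fᶜ.card = n - (2 * f + 1 - T) := by
    rw [Finset.card_compl, Fintype.card_fin, hFcard]
  -- `d = T + (n - 3 * f - 1)`, and `n ≤ 3 * f + 3`.
  obtain ⟨d, hd, hdT⟩ : ∃ d, Fᶜ.card = f + d ∧ d ≤ T + 2 :=
    ⟨n - (2 * f + 1 - T) - f, by omega, by omega⟩
  -- Half of `s` rounded up plays two roles: the least number of Byzantine members that destroys an
  -- honest majority, and the least number of slow members that leaves the quota `s / 2 + 1`
  -- unfilled by fast ones.
  set h := s - s / 2 with hh
  set X : Finset (Fin n) → ℕ := fun c => (c ∩ Fᶜ).card + 1 - h with hX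
  have hN : (0 : ℝ) < n.choose s := by exact_mod_cast Nat.choose_pos hsn
  have hdh : d * h ≤ (T + 2) * s := Nat.mul_le_mul hdT (by omega)
  have hchoose : Fᶜ.card.choose h * (n - Fᶜ.card).choose (s - h)
      ≤ 2 * (((Finset.univ : Finset (Fin n)).powersetCard s).filter
          fun c => ¬ HonestMajority byz c).card := by
    calc Fᶜ.card.choose h * (n - Fᶜ.card).choose (s - h)
        ≤ (2 * f.choose h) * (n - f).choose (s - h) := by
          refine Nat.mul_le_mul ?_ (Nat.choose_le_choose _ (by omega))
          rw [hd]
          exact choose_add_le_two_mul f h d (by omega) (by omega) (by omega)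
      _ = 2 * (byz.card.choose h * (n - byz.card).choose (s - h)) := by rw [hbyz, mul_assoc]
      _ ≤ _ := Nat.mul_le_mul_left _
          (choose_mul_choose_le_card_not_honestMajority byz (by omega) (by omega))
  have hsum : ∑ c ∈ (Finset.univ : Finset (Fin n)).powersetCard s, (X c : ℝ)
      ≤ 32 * (((Finset.univ : Finset (Fin n)).powersetCard s).filter
          fun c => ¬ HonestMajority byz c).card := by
    -- The slow set is about a third of the nodes, so the true decay ratio is near 1/2; `hTf` and
    -- `hsf` keep it below 3/4.
    have h1 := sum_excess_le (s := s) (h := h) Fᶜ (by omega) (by omega) (by omega)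
    have h2 : ((Fᶜ.card.choose h * (n - Fᶜ.card).choose (s - h) : ℕ) : ℝ)
      ≤ 2 * (((Finset.univ : Finset (Fin n)).powersetCard s).filter
          fun c => ¬ HonestMajority byz c).card := by exact_mod_cast hchoose
    simp only [hX]
    linarith
  have hbad := hC.mul_card_not_honestMajority_le hsn byz hδ hμ
  have hmarkov := card_filter_le_sum_mul_le (K := K) (s := s) X T hsn
  refine ⟨fastFirstAdversary K byz sender F, fun R => ?_⟩
  refine (hC.measureReal_le hsn (P := fun c => T ≤ ∑ k, X (c k)) ?_).trans_lt ?_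
  · intro ω hω hE
    rw [mem_committeeTuples] at hω
    have h1 := hE.trans (ncard_honestAcks_le hsF (R ω) (C ω))
    have h2 : ∀ k, (C ω k ∩ Fᶜ).card + (s / 2 + 1) - (C ω k).card = X (C ω k) := by
      intro k
      rw [hω k]
      simp only [hX]
      omega
    rw [Finset.sum_congr rfl fun k _ => h2 k, hFb] at h1
    omega
  · have hT0 : (0 : ℝ) < T := lt_of_le_of_lt (by positivity) hT
    refine lt_of_mul_lt_mul_right (a := (T : ℝ)) ?_ hT0.le
    have h1 : (∑ c ∈ (Finset.univ : Finset (Fin n)).powersetCard s, (X c : ℝ)) / n.choose s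
        ≤ 32 * ((((Finset.univ : Finset (Fin n)).powersetCard s).filter
          fun c => ¬ HonestMajority byz c).card / (n.choose s : ℝ)) := by
      rw [mul_div_assoc']
      gcongr
    have h2 := mul_le_mul_of_nonneg_left h1 (Nat.cast_nonneg (α := ℝ) K)
    have h3 : 32 * (1 / δ) < δ * T := by
      rw [div_lt_iff₀ (by positivity)] at hT
      rw [mul_one_div, div_lt_iff₀ hδ]
      linarith
    exact (hmarkov.trans (h2.trans (by linarith))).trans_lt h3

theorem mainTheorem8 (ε : ℝ) (hε₀ : 0 ≤ ε) (hε₁ : ε < 1)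
    (nc : ℕ → ℕ) (hnc : (fun n => (nc n : ℝ)) =o[atTop] (fun n : ℕ => (n : ℝ))) :
    ∀ᶠ n : ℕ in atTop, ∀ f : ℕ, 3 * f < n → n ≤ 3 * f + 3 →
      ∀ (byz : Finset (Fin n)), byz.card = f → ∀ (sender : Fin n) (K : ℕ)
        (Ω : Type*) [MeasurableSpace Ω] (μ : Measure Ω) [IsProbabilityMeasure μ]
        (C : Ω → Fin K → Finset (Fin n)), IsUniformSample μ (nc n) C →
        1 - ε ≤ μ.real {ω | ∀ k, HonestMajority byz (C ω k)} →
        ∃ A : AsyncAdversary K byz sender,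
          ∀ R : Ω → SenderRun K (nc n / 2 + 1),
            μ.real {ω | f + 1 ≤ (honestAcks A (R ω) (C ω)).ncard} < 1 - ε := by
  have hδ : 0 < 1 - ε := by linarith
  obtain ⟨T, hT⟩ := exists_nat_gt (32 / (1 - ε) ^ 2)
  -- This gives `2 * (T + 2) * nc n ≤ n / 4 ≤ f`; the threshold `42 * T + 48` below gives `14 * T +
  -- 14 ≤ f`, both through `n ≤ 3 * f + 3`.
  have hc : (0 : ℝ) < 1 / (8 * (T + 2)) := by positivity
  filter_upwards [hnc.bound hc, eventually_ge_atTop (42 * T + 48)] with n hns hnT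
  intro f hf hn byz hbyz sender K Ω _ μ _ C hC hμ
  have h1 : 8 * ((T + 2) * nc n) ≤ n := by
    rw [Real.norm_natCast, Real.norm_natCast, one_div_mul_eq_div,
      le_div_iff₀ (by positivity)] at hns
    have : (8 : ℝ) * ((T + 2) * nc n) ≤ n := by linarith
    exact_mod_cast this
  exact exists_adversary_measureReal_lt hδ hT hf hn (by omega) (by omega) hbyz sender hC hμ
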